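/- Let $c$ and $d$ be positive integers, let $G=\langle a,b : ab^c=b^da\rangle$ be the Baumslag–Solitar group, and let $P$ be the submonoid of $G$ generated by $a$ and $b$. For $x,y\in P$ write $x\le y$ if $x^{-1}y\in P$, let $x\vee y$ be the least upper bound of $x$ and $y$ in $P$, and write $x\vee y=\infty$ if $x$ and $y$ have no common upper bound in $P$. (The pair $(G,P)$ is quasi-lattice ordered, so one of the two cases always occurs.) An element $W$ of a unital $C^*$-algebra is an isometry if $W^*W=1$. A Nica-covariant representation of $P$ in a unital $C^*$-algebra $B$ is a homomorphism of monoids $S:P\to B$ such that every $S_x$ is an isometry and, for all $x,y\in P$, $S_xS_x^*S_yS_y^*=S_{x\vee y}S_{x\vee y}^*$ if $x\vee y<\infty$ and $S_xS_x^*S_yS_y^*=0$ if $x\vee y=\infty$. Let $C^*(G,P)$ be the universal unital $C^*$-algebra generated by a Nica-covariant representation of $P$, and let $T:P\to C^*(G,P)$ be the universal Nica-covariant representation. Let $B$ be a unital $C^*$-algebra. (a) Suppose that $\pi:C^*(G,P)\to B$ is a unital $*$-homomorphism. Then $U:=\pi(T_b)$ and $V:=\pi(T_a)$ are isometries, and satisfy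 \begin{enumerate} \item[(1)] $VU^c=U^dV$; \item[(2)] $U^*V=U^{d-1}VU^{*c}$; \item[(3)] $V^*U^jV=0$ for $1\le j<d$. \end{enumerate} (b) Conversely, if $U$ and $V$ are isometries in $B$ satisfying (1), (2) and (3), then there is a Nica-covariant representation $S:P\to B$ such that $S_a=V$ and $S_b=U$, and there is a unital $*$-homomorphism $\pi_{U,V}:C^*(G,P)\to B$ such that $U=\pi_{U,V}(T_b)$ and $V=\pi_{U,V}(T_a)$. -/

import Mathlib

/-! ### The order of a pair `(G, P)` and Nica-covariant representations -/

section NicaCovariance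

variable {G : Type*} [Group G]

/-- The left-invariant order of `(G, P)`: `g ≤ h` means `g⁻¹ h ∈ P`. -/
def SemigroupLE (P : Submonoid G) (g h : G) : Prop := g⁻¹ * h ∈ P

/-- `z` is a common upper bound of `x` and `y` in `P`. -/
def IsCommonUpperBound (P : Submonoid G) (x y z : P) : Prop :=
  SemigroupLE P x z ∧ SemigroupLE P y z

/-- `z` is the least upper bound `x ∨ y` of `x` and `y` in `P`. -/
def IsJoin (P : Submonoid G) (x y z : P) : Prop :=
  IsCommonUpperBound P x y z ∧ ∀ w : P, IsCommonUpperBound P x y w → SemigroupLE P z w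

/-- A homomorphism `S` of the monoid `P` into a unital *-ring is a Nica-covariant (isometric)
representation if every `S x` is an isometry, `S x (S x)* S y (S y)* = S z (S z)*` when
`z = x ∨ y`, and `S x (S x)* S y (S y)* = 0` when `x` and `y` have no common upper bound
(that is, `x ∨ y = ∞`). -/
structure IsNicaCovariant {P : Submonoid G} {B : Type*} [Ring B] [StarRing B] (S : P →* B) :
    Prop where
  isometry : ∀ x : P, star (S x) * S x = 1
  join : ∀ x y z : P, IsJoin P x y z →
    S x * star (S x) * (S y * star (S y)) = S z * star (S z)
  no_join : ∀ x y : P, (¬ ∃ z : P, IsCommonUpperBound P x y z) →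
    S x * star (S x) * (S y * star (S y)) = 0

end NicaCovariance

/-! ### The free *-algebra on a set -/

noncomputable section FreeStarAlgebraSection

/-- The free unital complex *-algebra on a set `X`: the monoid algebra of the free monoid on the
symbols `Sum.inl x` (standing for the generator `x`) and `Sum.inr x` (standing for `x*`). -/
def FreeStarAlgebra (X : Type*) : Type _ := MonoidAlgebra ℂ (FreeMonoid (X ⊕ X))

namespace FreeStarAlgebra

variable {X : Type*}

instance : Ring (FreeStarAlgebra X) :=
  inferInstanceAs (Ring (MonoidAlgebra ℂ (FreeMonoid (X ⊕ X))))

instance : Algebra ℂ (FreeStarAlgebra X) :=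
  inferInstanceAs (Algebra ℂ (MonoidAlgebra ℂ (FreeMonoid (X ⊕ X))))

/-- The scalar multiple `z w` of a word `w`. -/
def term (w : FreeMonoid (X ⊕ X)) (z : ℂ) : FreeStarAlgebra X := MonoidAlgebra.single w z

theorem term_mul (w w' : FreeMonoid (X ⊕ X)) (z z' : ℂ) :
    term w z * term w' z' = term (w * w') (z * z') :=
  MonoidAlgebra.single_mul_single ..

/-- The generator `x`. -/
def gen (x : X) : FreeStarAlgebra X := term (FreeMonoid.of (Sum.inl x)) 1

/-- The involution of words: reverse the word and exchange the symbols `x` and `x*`. -/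
def wordStar : FreeMonoid (X ⊕ X) →* (FreeMonoid (X ⊕ X))ᵐᵒᵖ :=
  FreeMonoid.lift fun s => MulOpposite.op (FreeMonoid.of s.swap)

/-- The involution, as an additive map: conjugate the coefficients and star the words. -/
def starAddHom : FreeStarAlgebra X →+ FreeStarAlgebra X :=
  MonoidAlgebra.liftNC (R := MonoidAlgebra ℂ (FreeMonoid (X ⊕ X)))
    ((algebraMap ℂ (MonoidAlgebra ℂ (FreeMonoid (X ⊕ X)))).comp (starRingEnd ℂ)).toAddMonoidHom
    (fun w => MonoidAlgebra.single (wordStar w).unop 1)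

theorem starAddHom_term (w : FreeMonoid (X ⊕ X)) (z : ℂ) :
    starAddHom (term w z) = term (wordStar w).unop (star z) := by
  refine (MonoidAlgebra.liftNC_single _ _ _ _).trans ?_
  exact (term_mul 1 (wordStar w).unop (star z) 1).trans (by rw [one_mul, mul_one])

theorem induction_term {motive : FreeStarAlgebra X → Prop} (a : FreeStarAlgebra X)
    (zero : motive 0) (add : ∀ a b, motive a → motive b → motive (a + b))
    (single : ∀ w z, motive (term w z)) : motive a :=
  MonoidAlgebra.induction_linear a zero add single

theorem wordStar_wordStar (w : FreeMonoid (X ⊕ X)) :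
    (wordStar (wordStar w).unop).unop = w := by
  induction w using FreeMonoid.inductionOn' with
  | one => simp
  | of_mul x xs ih =>
    rw [map_mul, MulOpposite.unop_mul, map_mul, MulOpposite.unop_mul, ih]
    simp [wordStar]

instance : StarRing (FreeStarAlgebra X) where
  star := starAddHom
  star_involutive a := by
    induction a using induction_term with
    | zero => simp
    | add a b ha hb => simp [ha, hb]
    | single w z => simp [starAddHom_term, wordStar_wordStar]
  star_mul a b := by
    induction a using induction_term with
    | zero => simp
    | add a a' ha hb => simp [ha, hb, add_mul, mul_add]
    | single w z =>
      induction b using induction_term with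
      | zero => simp
      | add a a' ha hb => simp [ha, hb, add_mul, mul_add]
      | single w' z' => simp [starAddHom_term, term_mul, mul_comm]
  star_add a b := map_add _ a b

theorem star_term (w : FreeMonoid (X ⊕ X)) (z : ℂ) :
    star (term w z) = term (wordStar w).unop (star z) := starAddHom_term w z

theorem smul_term (w : FreeMonoid (X ⊕ X)) (r z : ℂ) : r • term w z = term w (r * z) :=
  MonoidAlgebra.smul_single ..

instance : StarModule ℂ (FreeStarAlgebra X) where
  star_smul r a := by
    induction a using induction_term with
    | zero => simp
    | add a b ha hb => simp [ha, hb]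
    | single w z => simp [smul_term, star_term]

theorem star_gen (x : X) : star (gen x) = term (FreeMonoid.of (Sum.inr x)) 1 := by
  simp [gen, star_term, wordStar]

end FreeStarAlgebra

end FreeStarAlgebraSection

/-! ### The universal C*-algebra `C*(G, P)` -/

noncomputable section UniversalCStarAlgebra

open FreeStarAlgebra UniformSpace

variable {G : Type*} [Group G]

/-- A C*-seminorm on the free *-algebra generated by symbols `x ∈ P`, for which the relations that
define a Nica-covariant representation of `P` hold modulo elements of seminorm zero. Up to
equivalence, these are the seminorms `a ↦ ‖a(S)‖` given by the Nica-covariant representations `S`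
of `P` in C*-algebras. -/
structure IsNicaSeminorm (P : Submonoid G) (p : Seminorm ℂ (FreeStarAlgebra P)) : Prop where
  mul_le : ∀ a b, p (a * b) ≤ p a * p b
  star_mul_self : ∀ a, p (star a * a) = p a * p a
  map_one : p (gen (1 : P) - 1) = 0
  map_mul : ∀ x y : P, p (gen (x * y) - gen x * gen y) = 0
  isometry : ∀ x : P, p (star (gen x) * gen x - 1) = 0
  join : ∀ x y z : P, IsJoin P x y z →
    p (gen x * star (gen x) * (gen y * star (gen y)) - gen z * star (gen z)) = 0
  no_join : ∀ x y : P, (¬ ∃ z : P, IsCommonUpperBound P x y z) →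
    p (gen x * star (gen x) * (gen y * star (gen y))) = 0

namespace IsNicaSeminorm

variable {P : Submonoid G} {p : Seminorm ℂ (FreeStarAlgebra P)}

theorem one_le_one (hp : IsNicaSeminorm P p) : p 1 ≤ 1 := by
  have h := hp.star_mul_self 1
  simp only [star_one, mul_one] at h
  nlinarith [apply_nonneg p 1]

theorem star_eq (hp : IsNicaSeminorm P p) (a : FreeStarAlgebra P) : p (star a) = p a := by
  have key : ∀ a, p a ≤ p (star a) := fun a => by
    have h1 := hp.star_mul_self a
    have h2 := hp.mul_le (star a) a
    rcases (apply_nonneg p a).eq_or_lt with h0 | h0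
    · rw [← h0]; exact apply_nonneg p _
    · exact le_of_mul_le_mul_right (h1 ▸ h2) h0
  refine le_antisymm ?_ (key a)
  simpa using key (star a)

theorem gen_le_one (hp : IsNicaSeminorm P p) (x : P) : p (gen x) ≤ 1 := by
  have h1 := hp.star_mul_self (gen x)
  have h2 := map_add_le_add p (star (gen x) * gen x - 1) 1
  rw [sub_add_cancel, hp.isometry x, h1] at h2
  nlinarith [apply_nonneg p (gen x), hp.one_le_one]

theorem word_le_one (hp : IsNicaSeminorm P p) (w : FreeMonoid (P ⊕ P)) : p (term w 1) ≤ 1 := by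
  induction w using FreeMonoid.inductionOn' with
  | one => exact hp.one_le_one
  | of_mul s w ih =>
    have h : term (FreeMonoid.of s * w) (1 : ℂ) = term (FreeMonoid.of s) 1 * term w 1 := by
      rw [term_mul, mul_one]
    have hs : p (term (FreeMonoid.of s) 1) ≤ 1 := by
      rcases s with x | x
      · exact hp.gen_le_one x
      · rw [← star_gen, hp.star_eq]; exact hp.gen_le_one x
    rw [h]
    exact (hp.mul_le _ _).trans (mul_le_one₀ hs (apply_nonneg p _) ih)

theorem bounded (P : Submonoid G) (a : FreeStarAlgebra P) :
    BddAbove (Set.range fun p : {p // IsNicaSeminorm P p} => p.1 a) := by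
  suffices h : ∃ C, ∀ p, IsNicaSeminorm P p → p a ≤ C by
    obtain ⟨C, hC⟩ := h
    exact ⟨C, by rintro _ ⟨p, rfl⟩; exact hC p.1 p.2⟩
  induction a using induction_term with
  | zero => exact ⟨0, fun p _ => by simp⟩
  | add a b ha hb =>
    obtain ⟨C, hC⟩ := ha
    obtain ⟨D, hD⟩ := hb
    exact ⟨C + D, fun p hp => (map_add_le_add p a b).trans (add_le_add (hC p hp) (hD p hp))⟩
  | single w z =>
    refine ⟨‖z‖, fun p hp => ?_⟩
    have h : term w z = z • term w (1 : ℂ) := by rw [smul_term, mul_one]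
    rw [h, map_smul_eq_mul]
    exact mul_le_of_le_one_right (norm_nonneg _) (hp.word_le_one w)

theorem zero (P : Submonoid G) : IsNicaSeminorm P 0 := by
  constructor <;> simp

instance (P : Submonoid G) : Nonempty {p // IsNicaSeminorm P p} := ⟨⟨0, zero P⟩⟩

end IsNicaSeminorm

/-- The free *-algebra on `P`, to be normed with the universal seminorm. -/
def NicaPreAlgebra (P : Submonoid G) : Type _ := FreeStarAlgebra P

namespace NicaPreAlgebra

variable (P : Submonoid G)

instance : Ring (NicaPreAlgebra P) := inferInstanceAs (Ring (FreeStarAlgebra P))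
instance : Algebra ℂ (NicaPreAlgebra P) := inferInstanceAs (Algebra ℂ (FreeStarAlgebra P))
instance : StarRing (NicaPreAlgebra P) := inferInstanceAs (StarRing (FreeStarAlgebra P))
instance : StarModule ℂ (NicaPreAlgebra P) := inferInstanceAs (StarModule ℂ (FreeStarAlgebra P))

/-- The universal seminorm: the supremum of all the C*-seminorms for which the generators form a
Nica-covariant representation of `P`. -/
instance : Norm (NicaPreAlgebra P) where
  norm a := ⨆ p : {p // IsNicaSeminorm P p}, p.1 a

variable {P}

theorem le_norm {p : Seminorm ℂ (FreeStarAlgebra P)} (hp : IsNicaSeminorm P p)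
    (a : NicaPreAlgebra P) : p a ≤ ‖a‖ :=
  le_ciSup (IsNicaSeminorm.bounded P a) ⟨p, hp⟩

theorem norm_le {a : NicaPreAlgebra P} {C : ℝ}
    (h : ∀ p : Seminorm ℂ (FreeStarAlgebra P), IsNicaSeminorm P p → p a ≤ C) : ‖a‖ ≤ C :=
  ciSup_le fun p => h p.1 p.2

theorem norm_nonneg' (a : NicaPreAlgebra P) : 0 ≤ ‖a‖ :=
  (apply_nonneg _ _).trans (le_norm (IsNicaSeminorm.zero P) a)

theorem norm_eq_zero' {a : NicaPreAlgebra P}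
    (h : ∀ p : Seminorm ℂ (FreeStarAlgebra P), IsNicaSeminorm P p → p a = 0) : ‖a‖ = 0 :=
  le_antisymm (norm_le fun p hp => (h p hp).le) (norm_nonneg' a)

instance : SeminormedRing (NicaPreAlgebra P) :=
  { (inferInstance : Ring (NicaPreAlgebra P)),
    (AddGroupSeminorm.toSeminormedAddCommGroup
      { toFun := fun a : NicaPreAlgebra P => ‖a‖
        map_zero' := norm_eq_zero' fun p _ => map_zero p
        add_le' := fun a b => norm_le fun p hp => (map_add_le_add p a b).trans
          (add_le_add (le_norm hp a) (le_norm hp b))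
        neg' := fun a => congrArg iSup (funext fun p => map_neg_eq_map p.1 a) }) with
    norm_mul_le := fun a b => norm_le fun p hp => (hp.mul_le a b).trans
      (mul_le_mul (le_norm hp a) (le_norm hp b) (apply_nonneg p _) (norm_nonneg' a)) }

instance : NormedAlgebra ℂ (NicaPreAlgebra P) where
  norm_smul_le r a := norm_le fun p hp => (map_smul_eq_mul p r a).trans_le
    (mul_le_mul_of_nonneg_left (le_norm hp a) (norm_nonneg r))

instance : NormedStarGroup (NicaPreAlgebra P) where
  norm_star_le a := norm_le fun _ hp => (hp.star_eq a).trans_le (le_norm hp a)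

theorem norm_mul_self_le' (a : NicaPreAlgebra P) : ‖a‖ * ‖a‖ ≤ ‖star a * a‖ := by
  have h : ‖a‖ ≤ √‖star a * a‖ := norm_le fun p hp =>
    Real.le_sqrt_of_sq_le ((sq (p a)).trans_le
      ((hp.star_mul_self a).symm.trans_le (le_norm hp (star a * a))))
  calc ‖a‖ * ‖a‖ ≤ √‖star a * a‖ * √‖star a * a‖ :=
        mul_self_le_mul_self (norm_nonneg' a) h
    _ = ‖star a * a‖ := Real.mul_self_sqrt (norm_nonneg' _)

/-- The generator `x ∈ P`. -/
def gen (x : P) : NicaPreAlgebra P := FreeStarAlgebra.gen x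

end NicaPreAlgebra

/-- The universal C*-algebra `C*(G, P)`: the (Hausdorff) completion of the free *-algebra on `P` in
the universal seminorm. -/
def NicaCStarAlgebra (P : Submonoid G) : Type _ := Completion (NicaPreAlgebra P)

namespace NicaCStarAlgebra

variable {P : Submonoid G}

instance : NormedRing (NicaCStarAlgebra P) :=
  inferInstanceAs (NormedRing (Completion (NicaPreAlgebra P)))
instance : CompleteSpace (NicaCStarAlgebra P) :=
  inferInstanceAs (CompleteSpace (Completion (NicaPreAlgebra P)))
instance : Algebra ℂ (NicaCStarAlgebra P) :=
  inferInstanceAs (Algebra ℂ (Completion (NicaPreAlgebra P)))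
instance : NormedAlgebra ℂ (NicaCStarAlgebra P) where
  norm_smul_le := norm_smul_le (α := ℂ) (β := Completion (NicaPreAlgebra P))

/-- The canonical map of the free *-algebra on `P` into `C*(G, P)`. -/
def ofPre : NicaPreAlgebra P →+* NicaCStarAlgebra P := Completion.coeRingHom

theorem norm_ofPre (a : NicaPreAlgebra P) : ‖ofPre a‖ = ‖a‖ := Completion.norm_coe a

theorem isometry_ofPre : Isometry (ofPre : NicaPreAlgebra P → NicaCStarAlgebra P) :=
  Completion.coe_isometry

theorem denseRange_ofPre : DenseRange (ofPre : NicaPreAlgebra P → NicaCStarAlgebra P) :=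
  Completion.denseRange_coe

theorem ofPre_smul (r : ℂ) (a : NicaPreAlgebra P) : ofPre (r • a) = r • ofPre a :=
  Completion.coe_smul r a

/-- The involution of `C*(G, P)` extends that of the free *-algebra by continuity. -/
instance : Star (NicaCStarAlgebra P) where
  star := Completion.map (star : NicaPreAlgebra P → NicaPreAlgebra P)

theorem star_ofPre (a : NicaPreAlgebra P) : star (ofPre a) = ofPre (star a) :=
  Completion.map_coe star_isometry.uniformContinuous a

theorem continuous_star' : Continuous (star : NicaCStarAlgebra P → NicaCStarAlgebra P) :=
  Completion.continuous_map

theorem ext_ofPre {X : Type*} [TopologicalSpace X] [T2Space X] {f g : NicaCStarAlgebra P → X}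
    (hf : Continuous f) (hg : Continuous g) (h : ∀ a, f (ofPre a) = g (ofPre a)) : f = g :=
  denseRange_ofPre.equalizer hf hg (funext h)

instance : StarRing (NicaCStarAlgebra P) where
  star_involutive := by
    refine congrFun (ext_ofPre (f := fun a => star (star a)) (g := id)
      (continuous_star'.comp continuous_star') continuous_id fun a => ?_)
    simp [star_ofPre]
  star_add a b := by
    have hs := continuous_star' (P := P)
    revert b
    refine congrFun (ext_ofPre (f := fun b => star (a + b)) (g := fun b => star a + star b)
      (by fun_prop) (by fun_prop) fun b => ?_)
    revert a
    refine congrFun (ext_ofPre (f := fun a => star (a + ofPre b))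
      (g := fun a => star a + star (ofPre b)) (by fun_prop) (by fun_prop) fun a => ?_)
    simp only [star_ofPre, ← map_add, star_add]
  star_mul a b := by
    have hs := continuous_star' (P := P)
    revert b
    refine congrFun (ext_ofPre (f := fun b => star (a * b)) (g := fun b => star b * star a)
      (by fun_prop) (by fun_prop) fun b => ?_)
    revert a
    refine congrFun (ext_ofPre (f := fun a => star (a * ofPre b))
      (g := fun a => star (ofPre b) * star a) (by fun_prop) (by fun_prop) fun a => ?_)
    simp only [star_ofPre, ← map_mul, star_mul]

instance : CStarAlgebra (NicaCStarAlgebra P) where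
  norm_mul_self_le a := by
    have hs := continuous_star' (P := P)
    refine denseRange_ofPre.induction_on (p := fun a : NicaCStarAlgebra P =>
      ‖a‖ * ‖a‖ ≤ ‖star a * a‖) a (isClosed_le (by fun_prop) (by fun_prop)) fun a => ?_
    rw [star_ofPre, ← map_mul, norm_ofPre, norm_ofPre]
    exact NicaPreAlgebra.norm_mul_self_le' a
  star_smul r := by
    have hs := continuous_star' (P := P)
    refine congrFun (ext_ofPre (f := fun a : NicaCStarAlgebra P => star (r • a))
      (g := fun a => star r • star a) (hs.comp (continuous_const_smul r))
      (hs.const_smul (star r)) fun a => ?_)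
    rw [← ofPre_smul, star_ofPre, star_ofPre, ← ofPre_smul, star_smul]

theorem ofPre_eq {a b : NicaPreAlgebra P}
    (h : ∀ p : Seminorm ℂ (FreeStarAlgebra P), IsNicaSeminorm P p → p (a - b) = 0) :
    (ofPre a : NicaCStarAlgebra P) = ofPre b := by
  have h0 : ‖ofPre (a - b)‖ = 0 :=
    (norm_ofPre _).trans (NicaPreAlgebra.norm_eq_zero' h)
  rw [norm_eq_zero, map_sub, sub_eq_zero] at h0
  exact h0

/-- The universal Nica-covariant representation `T : P → C*(G, P)`. -/
def univRep (P : Submonoid G) : P →* NicaCStarAlgebra P where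
  toFun x := ofPre (NicaPreAlgebra.gen x)
  map_one' := (ofPre_eq fun _ hp => hp.map_one).trans (map_one ofPre)
  map_mul' x y := (ofPre_eq fun _ hp => hp.map_mul x y).trans (map_mul ofPre _ _)

theorem univRep_isNicaCovariant (P : Submonoid G) : IsNicaCovariant (univRep P) := by
  have hT : ∀ x : P, univRep P x = ofPre (NicaPreAlgebra.gen x) := fun _ => rfl
  refine ⟨fun x => ?_, fun x y z h => ?_, fun x y h => ?_⟩
  · rw [hT, star_ofPre, ← map_mul, ← map_one ofPre]
    exact ofPre_eq fun _ hp => hp.isometry x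
  · simp only [hT, star_ofPre, ← map_mul]
    exact ofPre_eq fun _ hp => hp.join x y z h
  · simp only [hT, star_ofPre, ← map_mul]
    rw [← map_zero ofPre]
    refine ofPre_eq fun p hp => ?_
    rw [sub_zero]
    exact hp.no_join x y h

/-- Evaluation of an element of the free *-algebra at a representation. -/
def eval {B : Type*} [CStarAlgebra B] (S : P →* B) : FreeStarAlgebra P →ₐ[ℂ] B :=
  MonoidAlgebra.lift ℂ B _ (FreeMonoid.lift (Sum.elim S fun x => star (S x)))

theorem eval_term {B : Type*} [CStarAlgebra B] (S : P →* B) (w : FreeMonoid (P ⊕ P)) (z : ℂ) :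
    eval S (term w z) = z • FreeMonoid.lift (Sum.elim S fun x => star (S x)) w :=
  MonoidAlgebra.lift_single ..

theorem eval_gen {B : Type*} [CStarAlgebra B] (S : P →* B) (x : P) : eval S (gen x) = S x := by
  rw [gen, eval_term]; simp

theorem eval_star {B : Type*} [CStarAlgebra B] (S : P →* B) (a : FreeStarAlgebra P) :
    eval S (star a) = star (eval S a) := by
  induction a using induction_term with
  | zero => simp
  | add a b ha hb => simp [ha, hb]
  | single w z =>
    rw [star_term, eval_term, eval_term, star_smul]
    congr 1
    induction w using FreeMonoid.inductionOn' with
    | one => simp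
    | of_mul s w ih =>
      rw [map_mul, MulOpposite.unop_mul, map_mul, map_mul, star_mul, ih]
      rcases s with x | x <;> simp [wordStar]

theorem isNicaSeminorm_eval {B : Type*} [CStarAlgebra B] {S : P →* B} (hS : IsNicaCovariant S) :
    IsNicaSeminorm P ((normSeminorm ℂ B).comp (eval S).toLinearMap) := by
  constructor <;> intros <;> simp [eval_star, eval_gen, norm_mul_le, CStarRing.norm_star_mul_self,
    hS.isometry, sub_eq_zero]
  · exact hS.join _ _ _ ‹_›
  · exact hS.no_join _ _ ‹_›

/-- Evaluation, on the same algebra with the universal seminorm. -/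
def evalPre {B : Type*} [CStarAlgebra B] (S : P →* B) : NicaPreAlgebra P →ₐ[ℂ] B := eval S

/-- The universal property of `(C*(G, P), T)`. -/
theorem existsUnique_lift {B : Type*} [CStarAlgebra B] {S : P →* B} (hS : IsNicaCovariant S) :
    ∃! π : NicaCStarAlgebra P →⋆ₐ[ℂ] B, ∀ x, π (univRep P x) = S x := by
  have hle : ∀ a : NicaPreAlgebra P, ‖evalPre S a‖ ≤ ‖a‖ :=
    fun a => NicaPreAlgebra.le_norm (isNicaSeminorm_eval hS) a
  have hcont : Continuous (evalPre S) :=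
    AddMonoidHomClass.continuous_of_bound (evalPre S) 1 fun a => (hle a).trans_eq (one_mul _).symm
  let φ : NicaCStarAlgebra P →+* B := Completion.extensionHom (evalPre S).toRingHom hcont
  have hφ : ∀ a, φ (ofPre a) = evalPre S a := Completion.extensionHom_coe _ hcont
  have hφc : Continuous φ := Completion.continuous_extension
  have hs := continuous_star' (P := P)
  let π : NicaCStarAlgebra P →⋆ₐ[ℂ] B :=
    { φ with
      commutes' := fun r => by
        have h : algebraMap ℂ (NicaCStarAlgebra P) r = ofPre (algebraMap ℂ _ r) := rfl
        change φ _ = _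
        rw [h, hφ, AlgHom.commutes]
      map_star' := congrFun (ext_ofPre (f := fun a => φ (star a)) (g := fun a => star (φ a))
        (hφc.comp hs) hφc.star fun a => by
          simp only [star_ofPre, hφ]; exact eval_star S a) }
  refine ⟨π, fun x => (hφ _).trans (eval_gen S x), fun ρ hρ => ?_⟩
  have hρc : Continuous ρ := AddMonoidHomClass.continuous_of_bound ρ 1 fun a =>
    (NonUnitalStarAlgHom.norm_apply_le ρ a).trans_eq (one_mul _).symm
  let ψ : FreeStarAlgebra P →ₐ[ℂ] B :=
    { toRingHom := (ρ : NicaCStarAlgebra P →+* B).comp ofPre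
      commutes' := fun r => AlgHomClass.commutes ρ r }
  have hψ : ∀ x, ψ (gen x) = S x := hρ
  have hψs : ∀ x, ψ (star (gen x)) = star (S x) := fun x =>
    (congrArg ρ (star_ofPre (NicaPreAlgebra.gen x)).symm).trans ((map_star ρ _).trans
      (congrArg star (hρ x)))
  have hword : ∀ w, ψ (term w 1) = eval S (term w 1) := fun w => by
    induction w using FreeMonoid.inductionOn' with
    | one => exact (map_one ψ).trans (map_one (eval S)).symm
    | of_mul s w ih =>
      have h : term (FreeMonoid.of s * w) (1 : ℂ) = term (FreeMonoid.of s) 1 * term w 1 := by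
        rw [term_mul, mul_one]
      rw [h, map_mul, map_mul, ih]
      congr 1
      rcases s with x | x
      · exact (hψ x).trans (eval_gen S x).symm
      · rw [← star_gen, hψs, eval_star, eval_gen]
  have hψe : ∀ a, ψ a = eval S a := fun a => by
    induction a using induction_term with
    | zero => simp
    | add a b ha hb => simp [ha, hb]
    | single w z =>
      have h : term w z = z • term w (1 : ℂ) := by rw [smul_term, mul_one]
      rw [h, map_smul, map_smul, hword]
  exact DFunLike.coe_injective (ext_ofPre hρc hφc fun a => (hψe a).trans (hφ a).symm)

end NicaCStarAlgebra

end UniversalCStarAlgebra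

/-! ### Baumslag-Solitar groups -/

/-- The names of the two generators. -/
inductive BSGenerator
  | a
  | b

/-- The Baumslag-Solitar group `BS(c, d) = ⟨a, b : a b^c = b^d a⟩`. -/
abbrev BaumslagSolitar (c d : ℕ) : Type :=
  PresentedGroup
    ({FreeGroup.of BSGenerator.a * FreeGroup.of BSGenerator.b ^ c *
      (FreeGroup.of BSGenerator.b ^ d * FreeGroup.of BSGenerator.a)⁻¹} :
      Set (FreeGroup BSGenerator))

namespace BaumslagSolitar

/-- The submonoid `P` of `BS(c, d)` generated by `a` and `b`. -/
def positive (c d : ℕ) : Submonoid (BaumslagSolitar c d) :=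
  Submonoid.closure {PresentedGroup.of BSGenerator.a, PresentedGroup.of BSGenerator.b}

/-- The generator `a`, as an element of `P`. -/
def a (c d : ℕ) : positive c d :=
  ⟨PresentedGroup.of BSGenerator.a, Submonoid.subset_closure (by simp)⟩

/-- The generator `b`, as an element of `P`. -/
def b (c d : ℕ) : positive c d :=
  ⟨PresentedGroup.of BSGenerator.b, Submonoid.subset_closure (by simp)⟩

end BaumslagSolitar

/-! ### Positive words in two letters -/

/-! For (a), covariance is applied to two kinds of pairs. The join of `b` and `a` is `a b^c = b^d
a`, and multiplying its covariance identity by `T_b*` on the left and `T_a` on the right gives (2).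
For `1 ≤ j < d` the elements `a` and `b^j a` have no common upper bound, and this gives (3).
Applying `π` transports the relations to `B`.

For (b), a representation must first be defined on `P`, which is given only as a submonoid of a
group. Relation (1) suffices because `P` has the monoid presentation with that single relation. To
see this, map `P` to an HNN extension of `ℤ` with stable letter the image of `a`. Positive words
become reduced words, so by Britton's lemma the leading `b`-exponents of two equal words that
contain `a` agree mod `d` (`modEq_of_b_pow_mul_a_eq`). Moving the surplus through the first `a` and
cancelling reduces to shorter words (`wordProd_eq_of_wordProd_eq`).

Covariance then follows by reversing words: (2), (3) and the isometry relations rewrite `S_x* S_y`,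
letter by letter, either to `0` or to `S_p S_q*`. The same moves decide in `P` whether `x` and `y`
have a common multiple, and yield the least one as `x p = y q`. `Reverses` and `Orthogonal` carry
the two computations together, and squares of this kind can be pasted. -/

/-- The product `u ^ n₀ v u ^ n₁ v ⋯ v u ^ nₖ`, where `n₀` is the first argument and `n₁, …, nₖ` are
the entries of the list. -/
def wordProd {N : Type*} [Monoid N] (u v : N) : ℕ → List ℕ → N
  | n, [] => u ^ n
  | n, m :: L => u ^ n * (v * wordProd u v m L)

section wordProd

variable {N : Type*} [Monoid N] (u v : N)

@[simp] theorem wordProd_nil (n : ℕ) : wordProd u v n [] = u ^ n := rfl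

@[simp] theorem wordProd_cons (n m : ℕ) (L : List ℕ) :
    wordProd u v n (m :: L) = u ^ n * (v * wordProd u v m L) := rfl

theorem wordProd_add (k n : ℕ) (L : List ℕ) :
    wordProd u v (k + n) L = u ^ k * wordProd u v n L := by
  cases L <;> simp [pow_add, mul_assoc]

variable {u v}

theorem pow_mul_mul_eq_of_mul_pow_eq {c d : ℕ} (h : v * u ^ c = u ^ d * v) (k : ℕ) :
    u ^ (d * k) * v = v * u ^ (c * k) := by
  rw [pow_mul, pow_mul]
  exact (SemiconjBy.pow_right (show SemiconjBy v (u ^ c) (u ^ d) from h) k).symm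

end wordProd

namespace BaumslagSolitar

variable {c d : ℕ}

/-! ### The Baumslag-Solitar group as an HNN extension of `ℤ` -/

theorem zpowersHom_ofAdd_injective (hc : 0 < c) :
    Function.Injective (zpowersHom (Multiplicative ℤ) (Multiplicative.ofAdd (c : ℤ))) := by
  intro m n h
  simp only [zpowersHom_apply, ← ofAdd_zsmul, EmbeddingLike.apply_eq_iff_eq, smul_eq_mul] at h
  exact Multiplicative.toAdd.injective (mul_right_cancel₀ (by positivity) h)

/-- The isomorphism of `cℤ` onto `dℤ` that takes `c` to `d`. -/
noncomputable def multiplesEquiv (hc : 0 < c) (hd : 0 < d) :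
    (zpowersHom (Multiplicative ℤ) (Multiplicative.ofAdd (c : ℤ))).range ≃*
      (zpowersHom (Multiplicative ℤ) (Multiplicative.ofAdd (d : ℤ))).range :=
  (MonoidHom.ofInjective (zpowersHom_ofAdd_injective hc)).symm.trans
    (MonoidHom.ofInjective (zpowersHom_ofAdd_injective hd))

/-- The HNN extension of `ℤ` whose stable letter conjugates `c` to `d`. -/
abbrev HNN (hc : 0 < c) (hd : 0 < d) : Type :=
  HNNExtension (Multiplicative ℤ) _ _ (multiplesEquiv hc hd)

theorem of_ofAdd_one_pow (hc : 0 < c) (hd : 0 < d) (n : ℕ) :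
    (HNNExtension.of (Multiplicative.ofAdd 1) : HNN hc hd) ^ n =
      HNNExtension.of (Multiplicative.ofAdd (n : ℤ)) := by
  rw [← map_pow HNNExtension.of, ← ofAdd_nsmul, nsmul_one]

/-- The defining relation holds with `t` for `a` and the generator of `ℤ` for `b`, which is what
makes `toHNN` well defined. -/
theorem t_mul_of_pow (hc : 0 < c) (hd : 0 < d) :
    (HNNExtension.t : HNN hc hd) * HNNExtension.of (Multiplicative.ofAdd 1) ^ c =
      HNNExtension.of (Multiplicative.ofAdd 1) ^ d * HNNExtension.t := by
  have h := HNNExtension.t_mul_of (φ := multiplesEquiv hc hd)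
    (MonoidHom.ofInjective (zpowersHom_ofAdd_injective hc) (Multiplicative.ofAdd 1))
  rw [of_ofAdd_one_pow, of_ofAdd_one_pow]
  simpa only [multiplesEquiv, MulEquiv.trans_apply, MulEquiv.symm_apply_apply,
    MonoidHom.ofInjective_apply, zpowersHom_apply, toAdd_ofAdd, zpow_one] using h

/-- A homomorphism out of the Baumslag-Solitar group, given on the generators. -/
def lift {H : Type*} [Group H] (u v : H) (h : v * u ^ c = u ^ d * v) :
    BaumslagSolitar c d →* H :=
  PresentedGroup.toGroup (f := fun | .a => v | .b => u) (by
    rintro _ rfl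
    simp [h])

section lift

variable {H : Type*} [Group H] (u v : H) (h : v * u ^ c = u ^ d * v)

@[simp] theorem lift_a : lift u v h (a c d) = v := PresentedGroup.toGroup.of _

@[simp] theorem lift_b : lift u v h (b c d) = u := PresentedGroup.toGroup.of _

end lift

theorem a_mul_b_pow : a c d * b c d ^ c = b c d ^ d * a c d := by
  refine Subtype.ext (mul_inv_eq_one.1 ?_)
  exact PresentedGroup.one_of_mem (Set.mem_singleton _)

theorem b_pow_mul_a (k : ℕ) : b c d ^ (d * k) * a c d = a c d * b c d ^ (c * k) :=
  pow_mul_mul_eq_of_mul_pow_eq a_mul_b_pow k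

theorem positive_mul_left_cancel {x y z : positive c d} (h : x * y = x * z) : y = z :=
  Subtype.ext (mul_left_cancel (congrArg Subtype.val h))

/-! ### Positive elements and their words -/

@[elab_as_elim]
theorem induction_left {motive : positive c d → Prop} (x : positive c d) (one : motive 1)
    (a_mul : ∀ x, motive x → motive (a c d * x)) (b_mul : ∀ x, motive x → motive (b c d * x)) :
    motive x := by
  obtain ⟨x, hx⟩ := x
  induction hx using Submonoid.closure_induction_left with
  | one => exact one
  | mul_left y hy z hz ih =>
    rcases hy with rfl | rfl
    · exact a_mul _ ih
    · exact b_mul _ ih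

theorem exists_wordProd (x : positive c d) : ∃ n L, wordProd (b c d) (a c d) n L = x := by
  induction x using induction_left with
  | one => exact ⟨0, [], by simp⟩
  | a_mul x ih =>
    obtain ⟨n, L, rfl⟩ := ih
    exact ⟨0, n :: L, by simp⟩
  | b_mul x ih =>
    obtain ⟨n, L, rfl⟩ := ih
    exact ⟨1 + n, L, by rw [wordProd_add, pow_one]⟩

theorem eq_pow_or_eq_pow_mul_a_mul (x : positive c d) :
    (∃ n, x = b c d ^ n) ∨ ∃ n y, x = b c d ^ n * (a c d * y) := by
  obtain ⟨n, L, rfl⟩ := exists_wordProd x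
  cases L with
  | nil => exact .inl ⟨n, rfl⟩
  | cons m L => exact .inr ⟨n, _, rfl⟩

/-- The homomorphism of `P` into `ℤ` that counts the letters `a`. -/
def aCount (c d : ℕ) : positive c d →* Multiplicative ℤ :=
  (lift 1 (Multiplicative.ofAdd 1) (by simp)).comp (positive c d).subtype

@[simp] theorem aCount_a : aCount c d (a c d) = Multiplicative.ofAdd 1 :=
  lift_a (c := c) (d := d) _ _ (by simp)

@[simp] theorem aCount_b : aCount c d (b c d) = 1 :=
  lift_b (c := c) (d := d) _ _ (by simp)

theorem aCount_wordProd (n : ℕ) (L : List ℕ) :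
    aCount c d (wordProd (b c d) (a c d) n L) = Multiplicative.ofAdd (L.length : ℤ) := by
  induction L generalizing n with
  | nil => simp
  | cons m L ih => simp [ih, ← ofAdd_add, add_comm]

/-- The homomorphism of `P` into the HNN extension. -/
noncomputable def toHNN (hc : 0 < c) (hd : 0 < d) : positive c d →* HNN hc hd :=
  (lift _ _ (t_mul_of_pow hc hd)).comp (positive c d).subtype

@[simp] theorem toHNN_a (hc : 0 < c) (hd : 0 < d) : toHNN hc hd (a c d) = HNNExtension.t :=
  lift_a _ _ (t_mul_of_pow hc hd)

@[simp] theorem toHNN_b (hc : 0 < c) (hd : 0 < d) :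
    toHNN hc hd (b c d) = HNNExtension.of (Multiplicative.ofAdd 1) :=
  lift_b _ _ (t_mul_of_pow hc hd)

/-- A positive word, as a reduced word of the HNN extension. -/
def reducedWord (A A' : Subgroup (Multiplicative ℤ)) (n : ℕ) (L : List ℕ) :
    HNNExtension.NormalWord.ReducedWord (Multiplicative ℤ) A A' where
  head := Multiplicative.ofAdd (n : ℤ)
  toList := L.map fun m => (1, Multiplicative.ofAdd (m : ℤ))
  -- Every stable letter has exponent `+1`, so no pinch `t^ε g t^(-ε)` can occur.
  chain := by
    rw [List.isChain_map]
    exact (List.pairwise_of_forall fun _ _ _ => rfl).isChain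

theorem prod_reducedWord (hc : 0 < c) (hd : 0 < d) (n : ℕ) (L : List ℕ) :
    (reducedWord _ _ n L).prod (multiplesEquiv hc hd) =
      toHNN hc hd (wordProd (b c d) (a c d) n L) := by
  induction L generalizing n with
  | nil => simp [reducedWord, HNNExtension.NormalWord.ReducedWord.prod, of_ofAdd_one_pow]
  | cons m L ih =>
    rw [wordProd_cons, map_mul, map_mul, ← ih]
    simp [reducedWord, HNNExtension.NormalWord.ReducedWord.prod, of_ofAdd_one_pow, mul_assoc]

/-- The base group `ℤ` embeds in the HNN extension. -/
theorem b_pow_injective (hc : 0 < c) (hd : 0 < d) :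
    Function.Injective fun n : ℕ => b c d ^ n := by
  intro n m h
  have h' := congrArg (toHNN hc hd) h
  simp only [map_pow, toHNN_b] at h'
  rw [of_ofAdd_one_pow, of_ofAdd_one_pow] at h'
  have h'' := HNNExtension.of_injective _ h'
  simpa using h''

/-- Uniqueness of reduced words up to the associated subgroups: the exponents in front of the first
stable letter differ by an element of `dℤ`. -/
theorem modEq_of_b_pow_mul_a_eq (hc : 0 < c) (hd : 0 < d) {n m : ℕ} {x y : positive c d}
    (h : b c d ^ n * (a c d * x) = b c d ^ m * (a c d * y)) : n ≡ m [MOD d] := by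
  obtain ⟨p, L, rfl⟩ := exists_wordProd x
  obtain ⟨q, L', rfl⟩ := exists_wordProd y
  rw [← wordProd_cons, ← wordProd_cons] at h
  have h' := congrArg (toHNN hc hd) h
  rw [← prod_reducedWord, ← prod_reducedWord] at h'
  -- The first stable letter is `t^1`; the subgroup attached to exponent `-1` is the range `dℤ`.
  have h'' := (HNNExtension.ReducedWord.map_fst_eq_and_of_prod_eq _ h').2 1 (by simp [reducedWord])
  rw [HNNExtension.toSubgroup_neg_one] at h''
  obtain ⟨k, hk⟩ := h''
  have hk' : k.toAdd * (d : ℤ) = -n + m := congrArg Multiplicative.toAdd hk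
  rw [← Int.natCast_modEq_iff]
  exact (Int.modEq_iff_dvd).2 ⟨k.toAdd, by linarith⟩

theorem b_pow_mul_a_ne_b_pow (x : positive c d) (m n : ℕ) :
    b c d ^ m * (a c d * x) ≠ b c d ^ n := by
  obtain ⟨p, L, rfl⟩ := exists_wordProd x
  intro h
  have h' := congrArg (fun z => (aCount c d z).toAdd) h
  simp [aCount_wordProd] at h'
  omega

/-- Counting `a` leaves only powers of `b`, which are distinct. Hence the order on `P` is
antisymmetric and joins are unique. -/
theorem eq_one_of_mul_eq_one (hc : 0 < c) (hd : 0 < d) {x y : positive c d} (h : x * y = 1) :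
    x = 1 := by
  obtain ⟨n, rfl⟩ | ⟨n, x, rfl⟩ := eq_pow_or_eq_pow_mul_a_mul x
  · obtain ⟨m, rfl⟩ | ⟨m, y, rfl⟩ := eq_pow_or_eq_pow_mul_a_mul y
    · have := b_pow_injective hc hd (a₁ := n + m) (a₂ := 0) (by simpa [pow_add] using h)
      obtain rfl : n = 0 := by omega
      simp
    · rw [← mul_assoc, ← pow_add] at h
      exact absurd h (b_pow_mul_a_ne_b_pow y _ 0)
  · refine absurd ?_ (b_pow_mul_a_ne_b_pow (x * y) n 0)
    simpa only [mul_assoc, pow_zero] using h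

/-! ### `P` is the monoid with the presentation of the group -/

section monoidLift

variable {N : Type*} [Monoid N] {u v : N}

theorem wordProd_add_mul (huv : v * u ^ c = u ^ d * v) (n k q : ℕ) (L : List ℕ) :
    wordProd u v (n + d * k) (q :: L) = u ^ n * (v * wordProd u v (c * k + q) L) := by
  rw [wordProd_cons, wordProd_add, pow_add, mul_assoc, ← mul_assoc _ v,
    pow_mul_mul_eq_of_mul_pow_eq huv, mul_assoc]

/-- Induction on the number of letters `a`. The leading exponents differ by some `d k`; the relation
moves `b^(d k)` through the first `a`, as `b^(c k)`, and the common prefix cancels. Cancellation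
takes place in `P` alone, so `N` need not be cancellative. -/
theorem wordProd_eq_of_wordProd_eq (hc : 0 < c) (hd : 0 < d) (huv : v * u ^ c = u ^ d * v)
    {n m : ℕ} {L L' : List ℕ}
    (h : wordProd (b c d) (a c d) n L = wordProd (b c d) (a c d) m L') :
    wordProd u v n L = wordProd u v m L' := by
  induction L generalizing n m L' with
  | nil =>
    cases L' with
    | nil => rw [b_pow_injective hc hd h]
    | cons q L' => exact absurd h.symm (b_pow_mul_a_ne_b_pow _ _ _)
  | cons p L ih =>
    cases L' with
    | nil => exact absurd h (b_pow_mul_a_ne_b_pow _ _ _)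
    | cons q L' =>
      have hmod := modEq_of_b_pow_mul_a_eq hc hd h
      rcases le_total n m with hnm | hnm
      · obtain ⟨k, hk⟩ := (Nat.modEq_iff_dvd' hnm).1 hmod
        obtain rfl : m = n + d * k := by omega
        rw [wordProd_add_mul a_mul_b_pow] at h
        rw [wordProd_add_mul huv, wordProd_cons,
          ih (positive_mul_left_cancel (positive_mul_left_cancel h))]
      · obtain ⟨k, hk⟩ := (Nat.modEq_iff_dvd' hnm).1 hmod.symm
        obtain rfl : n = m + d * k := by omega
        rw [wordProd_add_mul a_mul_b_pow] at h
        rw [wordProd_add_mul huv, wordProd_cons,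
          ih (positive_mul_left_cancel (positive_mul_left_cancel h))]

/-- If `v u ^ c = u ^ d v` in a monoid, then `a ↦ v`, `b ↦ u` extends to a homomorphism on `P`. -/
theorem exists_monoidHom (hc : 0 < c) (hd : 0 < d) (huv : v * u ^ c = u ^ d * v) :
    ∃ S : positive c d →* N, S (a c d) = v ∧ S (b c d) = u := by
  -- `S` is evaluated on an arbitrarily chosen word for each element; `key` says that every other
  -- word gives the same value.
  choose n L hnL using exists_wordProd (c := c) (d := d)
  have key : ∀ k K, wordProd u v (n (wordProd (b c d) (a c d) k K))
      (L (wordProd (b c d) (a c d) k K)) = wordProd u v k K := fun k K =>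
    wordProd_eq_of_wordProd_eq hc hd huv (hnL _)
  let S : positive c d → N := fun x => wordProd u v (n x) (L x)
  have hone : S 1 = 1 := by simpa using key 0 []
  have ha : ∀ x, S (a c d * x) = v * S x := fun x => by
    obtain ⟨k, K, rfl⟩ := exists_wordProd x
    have h := key 0 (k :: K)
    simp only [wordProd_cons, pow_zero, one_mul] at h
    exact h.trans (congrArg (v * ·) (key k K).symm)
  have hb : ∀ x, S (b c d * x) = u * S x := fun x => by
    obtain ⟨k, K, rfl⟩ := exists_wordProd x
    have h := key (1 + k) K
    simp only [wordProd_add, pow_one] at h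
    exact h.trans (congrArg (u * ·) (key k K).symm)
  refine ⟨⟨⟨S, hone⟩, fun x y => ?_⟩, ?_, ?_⟩
  · change S (x * y) = S x * S y
    induction x using induction_left with
    | one => rw [one_mul, hone, one_mul]
    | a_mul x ih => rw [mul_assoc, ha, ha, ih, mul_assoc]
    | b_mul x ih => rw [mul_assoc, hb, hb, ih, mul_assoc]
  · change S (a c d) = v
    simpa [hone] using ha 1
  · change S (b c d) = u
    simpa [hone] using hb 1

end monoidLift

end BaumslagSolitar

/-! ### Reversing: rewriting `S x* S y` as `S p S q*` -/

section Reversing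

variable {G : Type*} [Group G] {P : Submonoid G} {B : Type*} [Ring B] [StarRing B]

theorem semigroupLE_iff_dvd {x y : P} : SemigroupLE P x y ↔ x ∣ y := by
  constructor
  · intro h
    exact ⟨⟨_, h⟩, Subtype.ext (by simp)⟩
  · rintro ⟨u, rfl⟩
    simp [SemigroupLE]

/-- `x p = y q` is a least common right multiple of `x` and `y`, and `S x* S y = S p S q*`. -/
structure Reverses (S : P →* B) (x y p q : P) : Prop where
  mul_eq : x * p = y * q
  dvd : ∀ w, x ∣ w → y ∣ w → x * p ∣ w
  star_mul_eq : star (S x) * S y = S p * star (S q)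

/-- `x` and `y` have no common right multiple, and `S x* S y = 0`. -/
structure Orthogonal (S : P →* B) (x y : P) : Prop where
  not_dvd : ∀ w, x ∣ w → ¬ y ∣ w
  star_mul_eq : star (S x) * S y = 0

theorem Submonoid.dvd_of_mul_dvd_mul_left {x y z : P} (h : x * y ∣ x * z) : y ∣ z := by
  obtain ⟨u, hu⟩ := h
  exact ⟨u, Subtype.ext (mul_left_cancel
    ((congrArg Subtype.val hu).trans (by push_cast; rw [mul_assoc])))⟩

namespace Reverses

variable {S : P →* B} {x y p q : P}

theorem self_mul (hx : star (S x) * S x = 1) (p : P) : Reverses S x (x * p) p 1 where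
  mul_eq := (mul_one _).symm
  dvd _ _ h := h
  star_mul_eq := by rw [map_mul, ← mul_assoc, hx]; simp

theorem symm (h : Reverses S x y p q) : Reverses S y x q p where
  mul_eq := h.mul_eq.symm
  dvd w hy hx := h.mul_eq ▸ h.dvd w hx hy
  star_mul_eq := by simpa using congrArg star h.star_mul_eq

/-- Pasting two squares: `S_{xx'}* S_y = S_{x'}* S_p S_q* = S_{p'} S_{q'}* S_q*`. A common multiple
of `xx'` and `y` is `x p r` for some `r`, and cancelling `x` leaves a common multiple of `x'` and
`p`. -/
theorem mul_left (h : Reverses S x y p q) {x' p' q' : P} (h' : Reverses S x' p p' q') :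
    Reverses S (x * x') y p' (q * q') where
  mul_eq := by rw [mul_assoc, h'.mul_eq, ← mul_assoc, h.mul_eq, mul_assoc]
  dvd w hx hy := by
    obtain ⟨r, rfl⟩ := h.dvd w (dvd_of_mul_right_dvd hx) hy
    rw [mul_assoc] at hx ⊢
    rw [mul_assoc]
    exact mul_dvd_mul_left x (h'.dvd _ (Submonoid.dvd_of_mul_dvd_mul_left hx) (dvd_mul_right _ _))
  star_mul_eq := by
    rw [map_mul, star_mul, mul_assoc, h.star_mul_eq, ← mul_assoc, h'.star_mul_eq, map_mul,
      star_mul, mul_assoc]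

theorem mul_right (h : Reverses S x y p q) {y' p' q' : P} (h' : Reverses S q y' p' q') :
    Reverses S x (y * y') (p * p') q' :=
  (h.symm.mul_left h'.symm).symm

theorem orthogonal_mul_left (h : Reverses S x y p q) {x' : P} (h' : Orthogonal S x' p) :
    Orthogonal S (x * x') y where
  not_dvd w hx hy := by
    obtain ⟨r, rfl⟩ := h.dvd w (dvd_of_mul_right_dvd hx) hy
    rw [mul_assoc] at hx
    exact h'.not_dvd _ (Submonoid.dvd_of_mul_dvd_mul_left hx) (dvd_mul_right _ _)
  star_mul_eq := by
    rw [map_mul, star_mul, mul_assoc, h.star_mul_eq, ← mul_assoc, h'.star_mul_eq, zero_mul]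

end Reverses

namespace Orthogonal

variable {S : P →* B} {x y : P}

theorem mul_left (h : Orthogonal S x y) (x' : P) : Orthogonal S (x * x') y where
  not_dvd w hx := h.not_dvd w (dvd_of_mul_right_dvd hx)
  star_mul_eq := by rw [map_mul, star_mul, mul_assoc, h.star_mul_eq, mul_zero]

theorem mul_right (h : Orthogonal S x y) (y' : P) : Orthogonal S x (y * y') where
  not_dvd w hx hy := h.not_dvd w hx (dvd_of_mul_right_dvd hy)
  star_mul_eq := by rw [map_mul, ← mul_assoc, h.star_mul_eq, zero_mul]

end Orthogonal

/-- A representation by isometries is Nica covariant if every pair of elements either reverses or is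
orthogonal. -/
theorem isNicaCovariant_of_reverses {S : P →* B} (hP : ∀ x y : P, x * y = 1 → x = 1)
    (hS : ∀ x, star (S x) * S x = 1)
    (h : ∀ x y, Orthogonal S x y ∨ ∃ p q, Reverses S x y p q) : IsNicaCovariant S where
  isometry := hS
  join x y z hz := by
    simp only [IsJoin, IsCommonUpperBound, semigroupLE_iff_dvd] at hz
    obtain h | ⟨p, q, h⟩ := h x y
    · exact absurd hz.1.2 (h.not_dvd z hz.1.1)
    · obtain ⟨r, rfl⟩ := h.dvd z hz.1.1 hz.1.2
      -- The join `x p r` must also lie below the common multiple `x p`, so `r` has a right inverse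
      -- and is `1`.
      have hr : x * p * r ∣ x * p * 1 := by
        rw [mul_one]
        exact hz.2 _ ⟨dvd_mul_right _ _, h.mul_eq ▸ dvd_mul_right _ _⟩
      obtain ⟨s, hs⟩ := Submonoid.dvd_of_mul_dvd_mul_left hr
      rw [hP r s hs.symm, mul_one]
      calc S x * star (S x) * (S y * star (S y))
          = S x * (star (S x) * S y) * star (S y) := by simp only [mul_assoc]
        _ = S x * S p * star (S y * S q) := by rw [h.star_mul_eq, star_mul]; simp only [mul_assoc]
        _ = S (x * p) * star (S (x * p)) := by rw [← map_mul, ← map_mul, h.mul_eq]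
  no_join x y hz := by
    simp only [IsCommonUpperBound, semigroupLE_iff_dvd] at hz
    obtain h | ⟨p, q, h⟩ := h x y
    · rw [mul_assoc, ← mul_assoc (star (S x)), h.star_mul_eq, zero_mul, mul_zero]
    · exact absurd ⟨_, dvd_mul_right x p, h.mul_eq ▸ dvd_mul_right _ _⟩ hz

end Reversing

namespace BaumslagSolitar

variable {c d : ℕ}

/-! ### Common multiples in `P` -/

theorem a_mul_ne_b_pow_mul_a_mul (hc : 0 < c) (hd : 0 < d) {j : ℕ} (hj : 1 ≤ j) (hjd : j < d)
    (x y : positive c d) : a c d * x ≠ b c d ^ j * (a c d * y) := by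
  intro h
  have h' := modEq_of_b_pow_mul_a_eq hc hd (n := 0) (m := j) (x := x) (y := y) (by simpa using h)
  have := (Nat.modEq_zero_iff_dvd.1 h'.symm)
  exact absurd (Nat.le_of_dvd hj this) (by omega)

theorem b_mul_b_pow_mul_a (hd : 0 < d) :
    b c d * (b c d ^ (d - 1) * a c d) = a c d * b c d ^ c := by
  rw [← mul_assoc, ← pow_succ', Nat.sub_add_cancel hd, a_mul_b_pow]

/-- If `a x = b y`, then `y` contains an `a`, so `a x = b^(n+1) a y'` with `d` dividing `n + 1 > 0`.
Writing `n + 1 = d (k + 1)` and moving these `b`s through `a` exposes the prefix `a b^c`. -/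
theorem a_mul_b_pow_dvd (hc : 0 < c) (hd : 0 < d) {w : positive c d} (ha : a c d ∣ w)
    (hb : b c d ∣ w) : a c d * b c d ^ c ∣ w := by
  obtain ⟨x, rfl⟩ := ha
  obtain ⟨y, hy⟩ := hb
  obtain ⟨n, rfl⟩ | ⟨n, y, rfl⟩ := eq_pow_or_eq_pow_mul_a_mul y
  · rw [← pow_succ'] at hy
    exact absurd (by simpa using hy) (b_pow_mul_a_ne_b_pow x 0 (n + 1))
  · rw [← mul_assoc, ← pow_succ'] at hy
    have h := modEq_of_b_pow_mul_a_eq hc hd (n := 0) (x := x) (by simpa using hy)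
    obtain ⟨k, hk⟩ := Nat.modEq_zero_iff_dvd.1 h.symm
    obtain _ | k := k
    · omega
    · rw [hy, hk, ← mul_assoc, b_pow_mul_a, mul_add_one, add_comm, pow_add, ← mul_assoc]
      exact (dvd_mul_right _ _).mul_right y

/-! ### The relations of a Nica-covariant representation -/

theorem isJoin_a_b (hc : 0 < c) (hd : 0 < d) :
    IsJoin (positive c d) (b c d) (a c d) (a c d * b c d ^ c) := by
  simp only [IsJoin, IsCommonUpperBound, semigroupLE_iff_dvd]
  exact ⟨⟨⟨_, (b_mul_b_pow_mul_a hd).symm⟩, dvd_mul_right _ _⟩,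
    fun w hw => a_mul_b_pow_dvd hc hd hw.2 hw.1⟩

/-- Each covariance identity is sandwiched between an adjoint and an isometry, which strips the
outer factors of the range projections. -/
theorem relations_of_isNicaCovariant (hc : 0 < c) (hd : 0 < d) {B : Type*} [Ring B] [StarRing B]
    {S : positive c d →* B} (hS : IsNicaCovariant S) :
    S (a c d) * S (b c d) ^ c = S (b c d) ^ d * S (a c d) ∧
    star (S (b c d)) * S (a c d) = S (b c d) ^ (d - 1) * S (a c d) * star (S (b c d)) ^ c ∧
    ∀ j : ℕ, 1 ≤ j → j < d → star (S (a c d)) * S (b c d) ^ j * S (a c d) = 0 := by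
  refine ⟨by simp only [← map_pow, ← map_mul, a_mul_b_pow], ?_, fun j hj hjd => ?_⟩
  · have h := hS.join _ _ _ (isJoin_a_b hc hd)
    have ha := hS.isometry (a c d)
    have hb := hS.isometry (b c d)
    calc star (S (b c d)) * S (a c d)
        = star (S (b c d)) * S (b c d) * star (S (b c d)) * S (a c d) *
            (star (S (a c d)) * S (a c d)) := by rw [ha, hb, one_mul, mul_one]
      _ = star (S (b c d)) * (S (b c d) * star (S (b c d)) * (S (a c d) * star (S (a c d)))) *
            S (a c d) := by simp only [mul_assoc]
      _ = star (S (b c d)) * (S (b c d * (b c d ^ (d - 1) * a c d)) *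
            star (S (a c d * b c d ^ c))) * S (a c d) := by rw [h, b_mul_b_pow_mul_a hd]
      _ = star (S (b c d)) * S (b c d) * S (b c d) ^ (d - 1) * S (a c d) *
            star (S (b c d)) ^ c * (star (S (a c d)) * S (a c d)) := by
          simp only [map_mul, map_pow, star_mul, star_pow, mul_assoc]
      _ = S (b c d) ^ (d - 1) * S (a c d) * star (S (b c d)) ^ c := by
          rw [ha, hb, one_mul, mul_one]
  · have h := hS.no_join (a c d) (b c d ^ j * a c d) (by
      simp only [IsCommonUpperBound, semigroupLE_iff_dvd]
      rintro ⟨z, ⟨x, rfl⟩, ⟨y, hy⟩⟩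
      exact a_mul_ne_b_pow_mul_a_mul hc hd hj hjd x y (hy.trans (mul_assoc _ _ _)))
    have ha := hS.isometry (a c d)
    have hb := hS.isometry (b c d ^ j * a c d)
    calc star (S (a c d)) * S (b c d) ^ j * S (a c d)
        = star (S (a c d)) * S (a c d) * star (S (a c d)) * S (b c d ^ j * a c d) *
            (star (S (b c d ^ j * a c d)) * S (b c d ^ j * a c d)) := by
          rw [ha, hb, one_mul, mul_one, map_mul, map_pow, mul_assoc]
      _ = star (S (a c d)) * (S (a c d) * star (S (a c d)) * (S (b c d ^ j * a c d) *
            star (S (b c d ^ j * a c d)))) * S (b c d ^ j * a c d) := by simp only [mul_assoc]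
      _ = 0 := by rw [h, mul_zero, zero_mul]

/-! ### Nica covariance from the relations -/

section Covariance

variable {B : Type*} [Ring B] [StarRing B] {S : positive c d →* B}

theorem isometry_of_generators (ha : star (S (a c d)) * S (a c d) = 1)
    (hb : star (S (b c d)) * S (b c d) = 1) (x : positive c d) : star (S x) * S x = 1 := by
  induction x using induction_left with
  | one => simp
  | a_mul x ih => rw [map_mul, star_mul, mul_assoc, ← mul_assoc _ _ (S x), ha, one_mul, ih]
  | b_mul x ih => rw [map_mul, star_mul, mul_assoc, ← mul_assoc _ _ (S x), hb, one_mul, ih]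

theorem reverses_b_a (hc : 0 < c) (hd : 0 < d)
    (h : star (S (b c d)) * S (a c d) =
      S (b c d) ^ (d - 1) * S (a c d) * star (S (b c d)) ^ c) :
    Reverses S (b c d) (a c d) (b c d ^ (d - 1) * a c d) (b c d ^ c) where
  mul_eq := b_mul_b_pow_mul_a hd
  dvd w hb ha := by
    rw [b_mul_b_pow_mul_a hd]
    exact a_mul_b_pow_dvd hc hd ha hb
  star_mul_eq := by rw [h]; simp only [map_mul, map_pow, star_pow]

theorem reverses_b_pow_b_pow (hS : ∀ x, star (S x) * S x = 1) (n m : ℕ) :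
    Reverses S (b c d ^ n) (b c d ^ m) (b c d ^ (m - n)) (b c d ^ (n - m)) := by
  rcases le_total n m with h | h
  · obtain ⟨k, rfl⟩ := Nat.exists_eq_add_of_le h
    simpa [pow_add] using Reverses.self_mul (hS (b c d ^ n)) (b c d ^ k)
  · obtain ⟨k, rfl⟩ := Nat.exists_eq_add_of_le h
    simpa [pow_add] using (Reverses.self_mul (hS (b c d ^ m)) (b c d ^ k)).symm

/-- Reversing one `b` of `b^(n+1)` against `a` leaves `b^n` to be reversed against `b^(d-1) a`. -/
theorem exists_reverses_b_pow_a (hc : 0 < c) (hd : 0 < d) (hS : ∀ x, star (S x) * S x = 1)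
    (h : star (S (b c d)) * S (a c d) =
      S (b c d) ^ (d - 1) * S (a c d) * star (S (b c d)) ^ c) (n : ℕ) :
    ∃ p m, Reverses S (b c d ^ n) (a c d) p (b c d ^ m) := by
  induction n using Nat.strong_induction_on with
  | _ n ih =>
    obtain _ | n := n
    · exact ⟨a c d, 0, by simpa using Reverses.self_mul (hS 1) (a c d)⟩
    · obtain ⟨p, m, hp⟩ := ih (n - (d - 1)) (by omega)
      have h₁ := (reverses_b_pow_b_pow hS n (d - 1)).mul_right hp
      have h₂ := (reverses_b_a hc hd h).mul_left h₁
      rw [← pow_succ', ← pow_add] at h₂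
      exact ⟨_, _, h₂⟩

/-- What remains of a power of `b` after passing a letter is again a power of `b`, so induction on
`y` with `n` free applies. -/
theorem exists_reverses_b_pow (hc : 0 < c) (hd : 0 < d) (hS : ∀ x, star (S x) * S x = 1)
    (h : star (S (b c d)) * S (a c d) =
      S (b c d) ^ (d - 1) * S (a c d) * star (S (b c d)) ^ c) (n : ℕ) (y : positive c d) :
    ∃ p m, Reverses S (b c d ^ n) y p (b c d ^ m) := by
  induction y using induction_left generalizing n with
  | one => exact ⟨1, n, by simpa using (Reverses.self_mul (hS 1) (b c d ^ n)).symm⟩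
  | a_mul y ih =>
    obtain ⟨p, m, hp⟩ := exists_reverses_b_pow_a hc hd hS h n
    obtain ⟨q, k, hq⟩ := ih m
    exact ⟨_, _, hp.mul_right hq⟩
  | b_mul y ih =>
    obtain ⟨q, k, hq⟩ := ih (n - 1)
    have h₁ := reverses_b_pow_b_pow hS n 1
    rw [pow_one] at h₁
    exact ⟨_, _, h₁.mul_right hq⟩

/-- For `y = b^n a y'` only `n mod d` matters: if it is `0`, then `a` divides `y`; otherwise (3)
kills the product and the residue excludes common multiples. -/
theorem orthogonal_or_reverses_a (hc : 0 < c) (hd : 0 < d) (hS : ∀ x, star (S x) * S x = 1)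
    (h : star (S (b c d)) * S (a c d) =
      S (b c d) ^ (d - 1) * S (a c d) * star (S (b c d)) ^ c)
    (h0 : ∀ j : ℕ, 1 ≤ j → j < d → star (S (a c d)) * S (b c d) ^ j * S (a c d) = 0)
    (y : positive c d) : Orthogonal S (a c d) y ∨ ∃ p q, Reverses S (a c d) y p q := by
  obtain ⟨n, rfl⟩ | ⟨n, y, rfl⟩ := eq_pow_or_eq_pow_mul_a_mul y
  · obtain ⟨p, m, hp⟩ := exists_reverses_b_pow_a hc hd hS h n
    exact .inr ⟨_, _, hp.symm⟩
  · have hn : b c d ^ n * (a c d * y) =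
        b c d ^ (n % d) * a c d * (b c d ^ (c * (n / d)) * y) := by
      conv_lhs => rw [← Nat.mod_add_div n d]
      simp only [pow_add, mul_assoc]
      rw [← mul_assoc _ (a c d) y, b_pow_mul_a]
      simp only [mul_assoc]
    rw [hn]
    rcases Nat.eq_zero_or_pos (n % d) with hj | hj
    · rw [hj, pow_zero, one_mul]
      exact .inr ⟨_, _, Reverses.self_mul (hS _) _⟩
    · refine .inl (Orthogonal.mul_right ⟨?_, ?_⟩ _)
      · rintro w ⟨x, rfl⟩ ⟨z, hz⟩
        exact a_mul_ne_b_pow_mul_a_mul hc hd hj (Nat.mod_lt _ hd) x z (hz.trans (mul_assoc _ _ _))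
      · rw [map_mul, map_pow, ← mul_assoc, h0 _ hj (Nat.mod_lt _ hd)]

theorem isNicaCovariant_of_relations (hc : 0 < c) (hd : 0 < d)
    (ha : star (S (a c d)) * S (a c d) = 1) (hb : star (S (b c d)) * S (b c d) = 1)
    (h : star (S (b c d)) * S (a c d) =
      S (b c d) ^ (d - 1) * S (a c d) * star (S (b c d)) ^ c)
    (h0 : ∀ j : ℕ, 1 ≤ j → j < d → star (S (a c d)) * S (b c d) ^ j * S (a c d) = 0) :
    IsNicaCovariant S := by
  have hS := isometry_of_generators ha hb
  refine isNicaCovariant_of_reverses (fun x y => eq_one_of_mul_eq_one hc hd) hS fun x => ?_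
  -- Passing a letter of `x` replaces `y` by a complement `p` that may be longer, so `y` stays
  -- universally quantified. Termination comes from `x` alone, since a single letter already
  -- reverses against, or is orthogonal to, any element.
  induction x using induction_left with
  | one => exact fun y => .inr ⟨y, 1, by simpa using Reverses.self_mul (hS 1) y⟩
  | a_mul x ih =>
    intro y
    obtain h' | ⟨p, q, h'⟩ := orthogonal_or_reverses_a hc hd hS h h0 y
    · exact .inl (h'.mul_left x)
    · exact (ih p).imp h'.orthogonal_mul_left fun ⟨_, _, h''⟩ => ⟨_, _, h'.mul_left h''⟩
  | b_mul x ih =>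
    intro y
    obtain ⟨p, m, h'⟩ := exists_reverses_b_pow hc hd hS h 1 y
    rw [pow_one] at h'
    exact (ih p).imp h'.orthogonal_mul_left fun ⟨_, _, h''⟩ => ⟨_, _, h'.mul_left h''⟩

end Covariance

end BaumslagSolitar

theorem proposition4p1 (c d : ℕ) (hc : 0 < c) (hd : 0 < d) {B : Type*} [CStarAlgebra B] :
    (∀ (π : NicaCStarAlgebra (BaumslagSolitar.positive c d) →⋆ₐ[ℂ] B) (U V : B),
      U = π (NicaCStarAlgebra.univRep (BaumslagSolitar.positive c d) (BaumslagSolitar.b c d)) → V = π (NicaCStarAlgebra.univRep (BaumslagSolitar.positive c d) (BaumslagSolitar.a c d)) →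
        star U * U = 1 ∧ star V * V = 1 ∧
        V * U ^ c = U ^ d * V ∧
        star U * V = U ^ (d - 1) * V * star U ^ c ∧
        ∀ j : ℕ, 1 ≤ j → j < d → star V * U ^ j * V = 0) ∧
    (∀ U V : B, star U * U = 1 → star V * V = 1 →
      V * U ^ c = U ^ d * V →
      star U * V = U ^ (d - 1) * V * star U ^ c →
      (∀ j : ℕ, 1 ≤ j → j < d → star V * U ^ j * V = 0) →
        (∃ S : BaumslagSolitar.positive c d →* B, IsNicaCovariant S ∧ S (BaumslagSolitar.a c d) = V ∧ S (BaumslagSolitar.b c d) = U) ∧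
        ∃ π : NicaCStarAlgebra (BaumslagSolitar.positive c d) →⋆ₐ[ℂ] B,
          U = π (NicaCStarAlgebra.univRep (BaumslagSolitar.positive c d) (BaumslagSolitar.b c d)) ∧ V = π (NicaCStarAlgebra.univRep (BaumslagSolitar.positive c d) (BaumslagSolitar.a c d))) := by
  have hT := NicaCStarAlgebra.univRep_isNicaCovariant (BaumslagSolitar.positive c d)
  refine ⟨?_, fun U V hU hV h₁ h₂ h₃ => ?_⟩
  · rintro π _ _ rfl rfl
    obtain ⟨h₁, h₂, h₃⟩ := BaumslagSolitar.relations_of_isNicaCovariant hc hd hT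
    refine ⟨?_, ?_, ?_, ?_, fun j hj hjd => ?_⟩
    · rw [← map_star, ← map_mul, hT.isometry, map_one]
    · rw [← map_star, ← map_mul, hT.isometry, map_one]
    · simpa only [map_mul, map_pow] using congrArg π h₁
    · simpa only [map_mul, map_pow, map_star] using congrArg π h₂
    · simpa only [map_mul, map_pow, map_star, map_zero] using congrArg π (h₃ j hj hjd)
  · obtain ⟨S, rfl, rfl⟩ := BaumslagSolitar.exists_monoidHom hc hd h₁
    have hS := BaumslagSolitar.isNicaCovariant_of_relations hc hd hV hU h₂ h₃
    obtain ⟨π, hπ, -⟩ := NicaCStarAlgebra.existsUnique_lift hS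
    exact ⟨⟨S, hS, rfl, rfl⟩, π, (hπ _).symm, (hπ _).symm⟩
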